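/- Let $(R,\mathfrak m)$ be a Noetherian Cohen–Macaulay local ring of Krull dimension one, with total quotient ring $Q(R)$, and let $\overline R$ be the integral closure of $R$ in $Q(R)$. Suppose that $\overline R$ is a finitely generated $R$-module and a discrete valuation ring with maximal ideal $\mathfrak n$, and that $R/\mathfrak m\cong\overline R/\mathfrak n$ as $R$-algebras (that is, the natural map $R/\mathfrak m\to\overline R/\mathfrak n$ is an isomorphism). Write $\ell_A$ for length over a ring $A$. Let $v:Q(R)\to\mathbb Z\cup\{\infty\}$ be the normalized valuation of $\overline R$, i.e. $v(a/b)=\ell_{\overline R}(\overline R/a\overline R)-\ell_{\overline R}(\overline R/b\overline R)$ for $a,b\in R$ with $b$ a non-zerodivisor of $R$. For an $R$-submodule $J\subseteq Q(R)$ put $v(J)=\min\{v(x): x\in J\}$ whenever the minimum exists. For an ideal $I$ of $R$ put $R:I=\{x\in Q(R): xI\subseteq R\}$ and $$h(I)=\inf\{\ell_R(R/\operatorname{Im} f): f\in\operatorname{Hom}_R(I,R)\}\in\mathbb N\cup\{\infty\}.$$ Let $I$ be a regular ideal of $R$, that is, an ideal of $R$ that contains a non-zerodivisor. Then $\ell_R(R/I)$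 and $h(I)$ are finite, the minimum $v(R:I)$ exists and is an integer, and $$h(I)=\ell_R(R/I)+v(R:I).$$ -/

import Mathlib

open scoped nonZeroDivisors

noncomputable section

/-- The inclusion of lengths (elements of `ℕ ∪ {∞}`) into `ℤ ∪ {∞}`. -/
def lengthToInt (n : ℕ∞) : WithTop ℤ := ENat.map (fun k : ℕ => (k : ℤ)) n

/-- A Noetherian local ring is Cohen–Macaulay if it has a regular sequence whose length is the Krull
dimension. (In a local ring, a regular sequence, for which `R ≠ (rs) R` is part of the definition,
lies in the maximal ideal.) -/
structure IsCohenMacaulayLocalRing (R : Type*) [CommRing R] [IsLocalRing R] : Prop where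
  isNoetherianRing : IsNoetherianRing R
  exists_isRegular : ∃ rs : List R, RingTheory.Sequence.IsRegular R rs ∧
    (rs.length : WithBot ℕ∞) = ringKrullDim R

/-- An ideal is regular if it contains a non-zerodivisor. -/
def Ideal.IsRegularIdeal {R : Type*} [CommRing R] (I : Ideal R) : Prop :=
  ∃ a ∈ I, a ∈ R⁰

/-- The `h`-invariant `h(M) = inf {ℓ_R(R / Im f) | f ∈ Hom_R(M, R)}` of a module, with values in
`ℕ ∪ {∞}`. -/
def hInvariant (R : Type*) [CommRing R] (M : Type*) [AddCommGroup M] [Module R M] : ℕ∞ :=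
  ⨅ f : M →ₗ[R] R, Module.length R (R ⧸ LinearMap.range f)

section

variable (R K : Type*) [CommRing R] [CommRing K] [Algebra R K]

/-- The length of `S / aS` over `S`, for `a ∈ R` and `S` the integral closure of `R` in `K`. -/
def closureLength (a : R) : ℕ∞ :=
  Module.length (integralClosure R K)
    (integralClosure R K ⧸ Ideal.span {algebraMap R (integralClosure R K) a})

/-- The colon `R : I = {x ∈ K | x I ⊆ R}`, computed in the total quotient ring `K` of `R`. -/
def colonIdeal (I : Ideal R) : Submodule R K :=
  (1 : Submodule R K) / IsLocalization.coeSubmodule K I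

/-- The normalized valuation `K → ℤ ∪ {∞}` on the total quotient ring `K` of `R`: if `x = a / b` with
`a, b ∈ R` and `b` a non-zerodivisor, it is `ℓ_S(S / aS) - ℓ_S(S / bS)`, where `S` is the integral
closure of `R`. It is computed here from one chosen fraction; `normalizedVal_eq` says that
any fraction gives the same value if `S` is a discrete valuation ring. -/
def normalizedVal [IsFractionRing R K] (x : K) : WithTop ℤ :=
  lengthToInt (closureLength R K (IsLocalization.sec R⁰ x).1)
    + ((-((closureLength R K (IsLocalization.sec R⁰ x).2).toNat : ℤ) : ℤ) : WithTop ℤ)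

/-- The value `v(J) = min {v(x) | x ∈ J}` of a submodule `J` of `K`. -/
def valueOf [IsFractionRing R K] (J : Submodule R K) : WithTop ℤ :=
  sInf (normalizedVal R K '' (J : Set K))

end

section

variable {R K : Type*} [CommRing R] [CommRing K] [Algebra R K]

theorem mem_colonIdeal_iff (I : Ideal R) (x : K) :
    x ∈ colonIdeal R K I ↔ ∀ a ∈ I, ∃ r : R, algebraMap R K r = x * algebraMap R K a := by
  simp [colonIdeal, Submodule.mem_div_iff_forall_mul_mem, Submodule.mem_one]

theorem closureLength_eq_addVal [IsDomain (integralClosure R K)]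
    [IsDiscreteValuationRing (integralClosure R K)] (a : R) :
    closureLength R K a =
      IsDiscreteValuationRing.addVal (integralClosure R K) (algebraMap R _ a) := by
  set S := integralClosure R K
  set s : S := algebraMap R S a
  have h1 := Order.coheight_orderIso (IsDiscreteValuationRing.idealOrderIsoENat S) (Ideal.span {s})
  have h2 : IsDiscreteValuationRing.addVal S (Submodule.IsPrincipal.generator (Ideal.span {s})) =
      IsDiscreteValuationRing.addVal S s :=
    (IsDiscreteValuationRing.addVal_eq_iff_associated _ _).2
      (Submodule.IsPrincipal.associated_generator_span_self s)
  rw [closureLength, Module.length_quotient, ← h1,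
    IsDiscreteValuationRing.idealOrderIsoENat_apply, h2, Order.coheight_toDual, Order.height_enat]

theorem normalizedVal_eq [IsFractionRing R K] [IsDomain (integralClosure R K)]
    [IsDiscreteValuationRing (integralClosure R K)] (x : K) (a b : R) (hb : b ∈ R⁰)
    (hx : x * algebraMap R K b = algebraMap R K a) :
    closureLength R K b ≠ ⊤ ∧ normalizedVal R K x + lengthToInt (closureLength R K b) =
      lengthToInt (closureLength R K a) := by
  have hinj : Function.Injective (algebraMap R (integralClosure R K)) := by
    have h := IsFractionRing.injective R K
    rw [IsScalarTower.algebraMap_eq R (integralClosure R K) K, RingHom.coe_comp] at h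
    exact Function.Injective.of_comp h
  have hnt : Nontrivial R := by
    by_contra h
    rw [not_nontrivial_iff_subsingleton] at h
    exact zero_ne_one (α := integralClosure R K)
      (by rw [← map_zero (algebraMap R _), ← map_one (algebraMap R _), Subsingleton.elim (0 : R) 1])
  have key : ∀ c ∈ R⁰, closureLength R K c ≠ ⊤ := by
    intro c hc h
    rw [closureLength_eq_addVal, IsDiscreteValuationRing.addVal_eq_top_iff] at h
    exact nonZeroDivisors.ne_zero hc (hinj (by rw [h, map_zero]))
  refine ⟨key b hb, ?_⟩
  rw [normalizedVal]
  have hs := IsLocalization.sec_spec R⁰ x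
  generalize IsLocalization.sec R⁰ x = p at hs
  obtain ⟨c, d, hd⟩ := p
  simp only at hs ⊢
  have hcb : c * b = a * d := by
    apply IsFractionRing.injective R K
    rw [map_mul, map_mul, ← hs, ← hx]
    ring
  have hlen : closureLength R K c + closureLength R K b =
      closureLength R K a + closureLength R K d := by
    simp only [closureLength_eq_addVal, ← IsDiscreteValuationRing.addVal_mul, ← map_mul, hcb]
  have hb' := key b hb
  have hd' := key d hd
  generalize closureLength R K b = lb at *
  generalize closureLength R K d = ld at *
  generalize closureLength R K a = la at *
  generalize closureLength R K c = lc at *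
  lift lb to ℕ using hb'
  lift ld to ℕ using hd'
  induction lc using ENat.recTopCoe with
  | top =>
    induction la using ENat.recTopCoe with
    | top => simp [lengthToInt]
    | coe la => exact absurd hlen.symm (by simp [← Nat.cast_add])
  | coe lc =>
    induction la using ENat.recTopCoe with
    | top => exact absurd hlen (by simp [← Nat.cast_add])
    | coe la =>
      have h : lc + lb = la + ld := by exact_mod_cast hlen
      simp only [lengthToInt, ENat.map_natCast, ENat.toNat_natCast]
      norm_cast
      omega

end

end

/-!
A homomorphism `f : I → R` on a regular ideal is multiplication by a unique `x ∈ R : I`, so that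
`Im f = x I`, and every `x ∈ R : I` arises in this way. The theorem therefore follows from the
formula `ℓ(R / x I) = ℓ(R / I) + v(x)`, valid in `ℤ ∪ {∞}` for every `x ∈ R : I`: the least value of
the left-hand side is `h(I)`, the least value of the right-hand side is `ℓ(R / I) + v(R : I)`, and
the first of these is attained because lengths are well-ordered.

The formula rests on additivity of length along an injective map
(`length_quotient_map_of_injective`). For `b ∈ I` regular and `a = f(b)` one has `b (Im f) = a I`;
comparing `R / b (Im f)` with `R / a I` gives
`ℓ(R / Im f) + ℓ(R / b R) = ℓ(R / a R) + ℓ(R / I)` (`length_quotient_range_add`). It remains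
to see that `ℓ(R / a R)` is the value of `a` (`length_quotient_range_mulLeft_eq_closureLength`).
With `S` the integral closure, comparing `S / a S` with `S / a R` gives
`ℓ_R(R / a R) = ℓ_R(S / a S)`, because `ℓ_R(S / R)` is finite: a common denominator `c` of `S` has
`c S ⊆ R`, so that `S / R` is a quotient of `S / c S`. Finally `ℓ_R(S / a S)` is computed by writing
`a` as a unit times a power of a uniformizer; each power contributes one, since the residue field of
`S` is a simple `R`-module.
-/

open scoped nonZeroDivisors

section Length

variable {R : Type*} [CommRing R]

/-! ### Additivity of length along injective maps -/

theorem length_quotient_map_of_injective {M M' : Type*} [AddCommGroup M] [Module R M]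
    [AddCommGroup M'] [Module R M'] (φ : M →ₗ[R] M') (hφ : Function.Injective φ)
    (N : Submodule R M) :
    Module.length R (M' ⧸ N.map φ) =
      Module.length R (M ⧸ N) + Module.length R (M' ⧸ LinearMap.range φ) := by
  have hle : N.map φ ≤ LinearMap.range φ := LinearMap.map_le_range
  refine Module.length_eq_add_of_exact (N.mapQ (N.map φ) φ (Submodule.le_comap_map φ N))
    (Submodule.factor hle) ?_ (Submodule.factor_surjective hle) ?_
  · rw [← LinearMap.ker_eq_bot, Submodule.mapQ, Submodule.ker_liftQ, LinearMap.ker_comp,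
      Submodule.ker_mkQ, Submodule.comap_map_eq_of_injective hφ, Submodule.mkQ_map_self]
  · rw [LinearMap.exact_iff, Submodule.range_mapQ, Submodule.factor, Submodule.mapQ,
      Submodule.ker_liftQ, LinearMap.ker_comp, Submodule.ker_mkQ, Submodule.comap_id]

/-- Additivity of `s ↦ ℓ_R(S / sS)` on products. -/
theorem length_quotient_range_mulLeft_mul {S : Type*} [CommRing S] [IsDomain S] [Algebra R S]
    {s : S} (hs : s ≠ 0) (t : S) :
    Module.length R (S ⧸ LinearMap.range (LinearMap.mulLeft R (s * t))) =
      Module.length R (S ⧸ LinearMap.range (LinearMap.mulLeft R t)) +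
        Module.length R (S ⧸ LinearMap.range (LinearMap.mulLeft R s)) := by
  rw [LinearMap.mulLeft_mul, LinearMap.range_comp]
  exact length_quotient_map_of_injective _ (mul_right_injective₀ hs) _

/-- For a homomorphism `f : I → R` and `b ∈ I`, the ideals `b (Im f)` and `f(b) I` agree; hence the
lengths of the quotients by `Im f` and `I` differ by those of the quotients by `bR` and `f(b)R`. -/
theorem length_quotient_range_add [IsDomain R] {I : Ideal R} (f : I →ₗ[R] R) {b : I}
    (hb : (b : R) ≠ 0) (hfb : f b ≠ 0) :
    Module.length R (R ⧸ LinearMap.range f) +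
        Module.length R (R ⧸ LinearMap.range (LinearMap.mulLeft R (b : R))) =
      Module.length R (R ⧸ I) +
        Module.length R (R ⧸ LinearMap.range (LinearMap.mulLeft R (f b))) := by
  have hcomp : LinearMap.mulLeft R (b : R) ∘ₗ f = LinearMap.mulLeft R (f b) ∘ₗ I.subtype := by
    ext i
    have h := f.map_smul (b : R) i
    rw [show (b : R) • i = (i : R) • b from Subtype.ext (mul_comm _ _), f.map_smul] at h
    simpa [mul_comm] using h.symm
  rw [← length_quotient_map_of_injective _ (mul_right_injective₀ hb),
    ← length_quotient_map_of_injective _ (mul_right_injective₀ hfb), ← LinearMap.range_comp, hcomp,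
    LinearMap.range_comp, Submodule.range_subtype]

/-! ### Lengths over a ring with the same residue field -/

theorem length_residueField_eq_one [IsLocalRing R] {S : Type*} [CommRing S] [IsLocalRing S]
    [Algebra R S] (hres : Nonempty (IsLocalRing.ResidueField R ≃ₐ[R] IsLocalRing.ResidueField S)) :
    Module.length R (IsLocalRing.ResidueField S) = 1 := by
  obtain ⟨e⟩ := hres
  rw [← e.toLinearEquiv.length_eq, Module.length_eq_of_surjective
    (R := IsLocalRing.ResidueField R) (IsLocalRing.residue_surjective), Module.length_eq_one]

/-- If the residue field of a discrete valuation ring `S` over `R` has length one over `R`, then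
`ℓ_R(S / sS)` is the valuation of `s`. -/
theorem length_quotient_range_mulLeft_eq_addVal {S : Type*} [CommRing S] [IsDomain S]
    [IsDiscreteValuationRing S] [Algebra R S]
    (hlen : Module.length R (IsLocalRing.ResidueField S) = 1) {s : S} (hs : s ≠ 0) :
    Module.length R (S ⧸ LinearMap.range (LinearMap.mulLeft R s)) =
      IsDiscreteValuationRing.addVal S s := by
  obtain ⟨ϖ, hϖ⟩ := IsDiscreteValuationRing.exists_irreducible S
  have hone : Module.length R (S ⧸ LinearMap.range (LinearMap.mulLeft R ϖ)) = 1 := by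
    let φ : S →ₗ[R] IsLocalRing.ResidueField S :=
      (IsScalarTower.toAlgHom R S (IsLocalRing.ResidueField S)).toLinearMap
    have hφ : Function.Surjective φ := IsLocalRing.residue_surjective
    have hker : LinearMap.range (LinearMap.mulLeft R ϖ) = LinearMap.ker φ := by
      ext x
      have h : x ∈ LinearMap.ker φ ↔ x ∈ IsLocalRing.maximalIdeal S :=
        IsLocalRing.residue_eq_zero_iff x
      rw [h, hϖ.maximalIdeal_eq, Ideal.mem_span_singleton']
      simp [mul_comm]
    rw [hker, (φ.quotKerEquivOfSurjective hφ).length_eq, hlen]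
  have hpow (n : ℕ) : Module.length R (S ⧸ LinearMap.range (LinearMap.mulLeft R (ϖ ^ n))) = n := by
    induction n with
    | zero =>
      rw [pow_zero, LinearMap.mulLeft_one, LinearMap.range_id, Nat.cast_zero, Module.length_eq_zero]
    | succ n ih =>
      rw [pow_succ, length_quotient_range_mulLeft_mul (pow_ne_zero n hϖ.ne_zero), hone, ih,
        Nat.cast_succ, add_comm]
  obtain ⟨n, u, rfl⟩ := IsDiscreteValuationRing.eq_unit_mul_pow_irreducible hs hϖ
  have hu : LinearMap.range (LinearMap.mulLeft R (u : S)) = ⊤ :=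
    LinearMap.range_eq_top.2 fun x ↦ ⟨(↑u⁻¹ : S) * x, by simp⟩
  rw [length_quotient_range_mulLeft_mul u.ne_zero, hpow, hu, Module.length_eq_zero, add_zero,
    IsDiscreteValuationRing.addVal_def' u hϖ]

end Length

section IntegralClosure

variable {R K : Type*} [CommRing R] [CommRing K] [Algebra R K] [IsFractionRing R K]

/-! ### Homomorphisms from a regular ideal -/

/-- Multiplication by an element of `R : I`, as a homomorphism `I → R`. -/
theorem exists_linearMap_of_mem_colonIdeal {I : Ideal R} {x : K} (hx : x ∈ colonIdeal R K I) :
    ∃ f : I →ₗ[R] R, ∀ i : I, algebraMap R K (f i) = x * algebraMap R K i := by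
  choose f hf using fun i : I ↦ (mem_colonIdeal_iff I x).1 hx i i.2
  refine ⟨{ toFun := f, map_add' := fun i j ↦ ?_, map_smul' := fun r i ↦ ?_ }, hf⟩ <;>
  apply IsFractionRing.injective R K
  · simp [hf, mul_add]
  · simp [hf, mul_left_comm]

/-- Every homomorphism `I → R` is multiplication by `f(b) / b`, for any regular `b ∈ I`. -/
theorem exists_mem_colonIdeal_of_linearMap {I : Ideal R} (hI : I.IsRegularIdeal) (f : I →ₗ[R] R) :
    ∃ x ∈ colonIdeal R K I, ∀ i : I, algebraMap R K (f i) = x * algebraMap R K i := by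
  obtain ⟨b, hbI, hb⟩ := hI
  have hmul (i : I) : algebraMap R K (f i) =
      IsLocalization.mk' K (f ⟨b, hbI⟩) (⟨b, hb⟩ : R⁰) * algebraMap R K i := by
    rw [mul_comm, IsLocalization.mul_mk'_eq_mk'_of_mul, eq_comm, IsLocalization.mk'_eq_iff_eq_mul,
      ← map_mul]
    congr 1
    have h := f.map_smul (i : R) ⟨b, hbI⟩
    rw [show (i : R) • (⟨b, hbI⟩ : I) = b • i from Subtype.ext (mul_comm _ _), f.map_smul] at h
    simpa [mul_comm] using h.symm
  exact ⟨_, (mem_colonIdeal_iff I _).2 fun i hi ↦ ⟨_, hmul ⟨i, hi⟩⟩, hmul⟩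

/-! ### Comparison with the integral closure -/

variable (R K) in
theorem algebraMap_integralClosure_injective :
    Function.Injective (algebraMap R (integralClosure R K)) := by
  have h := IsFractionRing.injective R K
  rw [IsScalarTower.algebraMap_eq R (integralClosure R K) K, RingHom.coe_comp] at h
  exact Function.Injective.of_comp h

variable (R K) in
/-- If the integral closure `S` of `R` is module-finite, its conductor is regular: a common
denominator `c` of a finite set of generators satisfies `cS ⊆ R`. -/
theorem exists_range_mulLeft_le_range_algebraMap [Module.Finite R (integralClosure R K)] :
    ∃ c ∈ R⁰, LinearMap.range (LinearMap.mulLeft R (algebraMap R (integralClosure R K) c)) ≤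
      LinearMap.range (Algebra.linearMap R (integralClosure R K)) := by
  obtain ⟨n, g, hg⟩ := Module.Finite.exists_fin (R := R) (M := integralClosure R K)
  obtain ⟨c, hc⟩ := IsLocalization.exist_integer_multiples_of_finite R⁰ fun i ↦ (g i : K)
  refine ⟨c, c.2, ?_⟩
  rw [LinearMap.range_eq_map, ← hg, Submodule.map_span_le]
  rintro _ ⟨i, rfl⟩
  obtain ⟨r, hr⟩ := hc i
  refine ⟨r, Subtype.ext ?_⟩
  simpa [Algebra.smul_def] using hr

variable [IsLocalRing R] [IsDomain (integralClosure R K)]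
  [IsDiscreteValuationRing (integralClosure R K)]

/-- The length of `R / aR` over `R` is the length of `S / aS` over the integral closure `S`: both
differ from `ℓ_R(S / aR)` by the finite number `ℓ_R(S / R)`. -/
theorem length_quotient_range_mulLeft_eq_closureLength [Module.Finite R (integralClosure R K)]
    (hres : Nonempty (IsLocalRing.ResidueField R ≃ₐ[R]
      IsLocalRing.ResidueField (integralClosure R K))) {a : R} (ha : a ≠ 0) :
    Module.length R (R ⧸ LinearMap.range (LinearMap.mulLeft R a)) = closureLength R K a := by
  set S := integralClosure R K
  have hinj : Function.Injective (algebraMap R S) := algebraMap_integralClosure_injective R K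
  have hne {r : R} (hr : r ≠ 0) : algebraMap R S r ≠ 0 :=
    (map_ne_zero_iff (algebraMap R S) hinj).2 hr
  have hval {r : R} (hr : r ≠ 0) :=
    length_quotient_range_mulLeft_eq_addVal (length_residueField_eq_one hres) (hne hr)
  have htop : Module.length R (S ⧸ LinearMap.range (Algebra.linearMap R S)) ≠ ⊤ := by
    obtain ⟨c, hc, hle⟩ := exists_range_mulLeft_le_range_algebraMap R K
    have hc0 : c ≠ 0 := nonZeroDivisors.ne_zero hc
    refine ne_top_of_le_ne_top ?_
      (Module.length_le_of_surjective _ (Submodule.factor_surjective hle))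
    rw [hval hc0, Ne, IsDiscreteValuationRing.addVal_eq_top_iff]
    exact hne hc0
  have hcomm : Algebra.linearMap R S ∘ₗ LinearMap.mulLeft R a =
      LinearMap.mulLeft R (algebraMap R S a) ∘ₗ Algebra.linearMap R S := by
    ext
    simp
  have h := length_quotient_map_of_injective (Algebra.linearMap R S) hinj
    (LinearMap.range (LinearMap.mulLeft R a))
  rw [← LinearMap.range_comp, hcomm, LinearMap.range_comp,
    length_quotient_map_of_injective (LinearMap.mulLeft R (algebraMap R S a))
      (mul_right_injective₀ (hne ha)), add_comm] at h
  rw [closureLength_eq_addVal, ← hval ha]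
  exact (WithTop.add_right_inj htop).1 h.symm

/-! ### The length of the cokernel of a homomorphism -/

/-- The formula `ℓ(R / xI) = ℓ(R / I) + v(x)`, where `f : I → R` is multiplication by `x`. Both sides
are `∞` if `x = 0`, because `R` itself has infinite length. -/
theorem lengthToInt_length_quotient_range [Module.Finite R (integralClosure R K)]
    (htop : Module.length R R = ⊤)
    (hres : Nonempty (IsLocalRing.ResidueField R ≃ₐ[R]
      IsLocalRing.ResidueField (integralClosure R K)))
    {I : Ideal R} (hI : I.IsRegularIdeal) (f : I →ₗ[R] R) (x : K)
    (hx : ∀ i : I, algebraMap R K (f i) = x * algebraMap R K i) :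
    lengthToInt (Module.length R (R ⧸ LinearMap.range f)) =
      lengthToInt (Module.length R (R ⧸ I)) + normalizedVal R K x := by
  have : IsDomain R := (algebraMap_integralClosure_injective R K).isDomain
  obtain ⟨b, hbI, hb⟩ := hI
  have hb0 : b ≠ 0 := nonZeroDivisors.ne_zero hb
  obtain ⟨hbtop, hval⟩ := normalizedVal_eq x (f ⟨b, hbI⟩) b hb (hx ⟨b, hbI⟩).symm
  by_cases ha : f ⟨b, hbI⟩ = 0
  · have hx0 : x = 0 := by
      have h := hx ⟨b, hbI⟩
      rw [ha, map_zero] at h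
      exact (IsLocalization.map_units K (⟨b, hb⟩ : R⁰)).mul_left_eq_zero.1 h.symm
    have hf : f = 0 := by
      ext i
      apply IsFractionRing.injective R K
      simp [hx, hx0]
    have hlen : Module.length R (R ⧸ LinearMap.range f) = ⊤ := by
      rw [hf, LinearMap.range_zero, (Submodule.quotEquivOfEqBot ⊥ rfl).length_eq, htop]
    have hv : normalizedVal R K x = ⊤ := by
      rw [ha, closureLength_eq_addVal (R := R) (K := K) 0, map_zero,
        IsDiscreteValuationRing.addVal_zero] at hval
      lift closureLength R K b to ℕ using hbtop with l
      exact (WithTop.add_eq_top.1 hval).resolve_right (WithTop.coe_ne_top (a := (l : ℤ)))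
    rw [hlen, hv, add_top]
    rfl
  · have h := length_quotient_range_add f (b := ⟨b, hbI⟩) hb0 ha
    simp only [length_quotient_range_mulLeft_eq_closureLength hres hb0,
      length_quotient_range_mulLeft_eq_closureLength hres ha] at h
    have hadd (m n : ℕ∞) : lengthToInt (m + n) = lengthToInt m + lengthToInt n :=
      ENat.map_add (Nat.castAddMonoidHom ℤ) m n
    have hne : lengthToInt (closureLength R K b) ≠ ⊤ := by
      lift closureLength R K b to ℕ using hbtop with l
      exact WithTop.coe_ne_top (a := (l : ℤ))
    rw [← WithTop.add_right_inj hne, add_assoc, hval, ← hadd, ← hadd, h]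

end IntegralClosure

/-- A ring of finite length over itself is Artinian, hence of dimension at most zero. -/
theorem length_self_eq_top_of_ringKrullDim_eq_one {R : Type*} [CommRing R]
    (hdim : ringKrullDim R = 1) : Module.length R R = ⊤ := by
  by_contra h
  have := (isFiniteLength_iff_isNoetherian_isArtinian.1 (Module.length_ne_top_iff.1 h)).2
  have : IsArtinianRing R := this
  have hle : ringKrullDim R ≤ 0 := Order.KrullDimLE.krullDim_le
  rw [hdim] at hle
  exact absurd hle (by decide)

theorem mainTheorem3 (R K : Type*) [CommRing R] [IsLocalRing R] [CommRing K] [Algebra R K]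
    [IsFractionRing R K] (hCM : IsCohenMacaulayLocalRing R) (hdim : ringKrullDim R = 1)
    [IsDomain (integralClosure R K)] [IsDiscreteValuationRing (integralClosure R K)]
    (hfin : Module.Finite R (integralClosure R K))
    (hres : Nonempty (IsLocalRing.ResidueField R ≃ₐ[R]
      IsLocalRing.ResidueField (integralClosure R K)))
    (I : Ideal R) (hI : I.IsRegularIdeal) :
    Module.length R (R ⧸ I) ≠ ⊤ ∧ hInvariant R I ≠ ⊤ ∧
    valueOf R K (colonIdeal R K I) ≠ ⊤ ∧
    IsLeast (normalizedVal R K '' (colonIdeal R K I : Set K)) (valueOf R K (colonIdeal R K I)) ∧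
    lengthToInt (hInvariant R I) =
      lengthToInt (Module.length R (R ⧸ I)) + valueOf R K (colonIdeal R K I) := by
  have htop := length_self_eq_top_of_ringKrullDim_eq_one hdim
  have key {f : I →ₗ[R] R} {x : K}
      (hx : ∀ i : I, algebraMap R K (f i) = x * algebraMap R K i) :=
    lengthToInt_length_quotient_range htop hres hI f x hx
  have hmono : StrictMono lengthToInt :=
    ENat.strictMono_map_iff.2 fun _ _ h ↦ Int.ofNat_lt.2 h
  have hcoe {n : ℕ∞} (hn : n ≠ ⊤) : lengthToInt n ≠ ⊤ := (hmono hn.lt_top).ne_top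
  have hlenI : Module.length R (R ⧸ I) ≠ ⊤ := by
    -- A regular `b ∈ I` gives the surjection `R / bR → R / I`.
    obtain ⟨b, hbI, hb⟩ := hI
    have hb0 := nonZeroDivisors.ne_zero hb
    have hle : LinearMap.range (LinearMap.mulLeft R b) ≤ I := by
      rintro _ ⟨r, rfl⟩
      exact I.mul_mem_right r hbI
    refine ne_top_of_le_ne_top ?_
      (Module.length_le_of_surjective _ (Submodule.factor_surjective hle))
    rw [length_quotient_range_mulLeft_eq_closureLength hres hb0]
    exact (normalizedVal_eq (0 : K) 0 b hb (by simp)).1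
  have hinv : hInvariant R I ≠ ⊤ := by
    refine ne_top_of_le_ne_top hlenI ((iInf_le _ I.subtype).trans_eq ?_)
    rw [Submodule.range_subtype]
  -- The infimum defining `h(I)` is attained, and multiplication by `x` attains it.
  obtain ⟨f, hf⟩ : ∃ f : I →ₗ[R] R, Module.length R (R ⧸ LinearMap.range f) = hInvariant R I :=
    ciInf_mem fun f : I →ₗ[R] R ↦ Module.length R (R ⧸ LinearMap.range f)
  obtain ⟨x, hxI, hx⟩ := exists_mem_colonIdeal_of_linearMap (K := K) hI f
  have hfx := key hx
  rw [hf] at hfx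
  have hleast : IsLeast (normalizedVal R K '' (colonIdeal R K I : Set K)) (normalizedVal R K x) := by
    refine ⟨⟨x, hxI, rfl⟩, ?_⟩
    rintro _ ⟨y, hy, rfl⟩
    obtain ⟨g, hg⟩ := exists_linearMap_of_mem_colonIdeal hy
    rw [← WithTop.add_le_add_iff_left (hcoe hlenI), ← hfx, ← key hg]
    exact hmono.monotone (iInf_le _ g)
  have hvalue : valueOf R K (colonIdeal R K I) = normalizedVal R K x := hleast.csInf_eq
  rw [hvalue]
  refine ⟨hlenI, hinv, fun h ↦ hcoe hinv ?_, hleast, hfx⟩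
  rw [hfx, h, add_top]
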